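/- Let $\mathfrak{g}$ be a complex Lie algebra (possibly infinite dimensional) and $\mathfrak{n}$ a Lie subalgebra of $\mathfrak{g}$. An $\mathfrak{n}$-module $V$ is called locally finite over $\mathfrak{n}$ if $\dim U(\mathfrak{n})v<\infty$ for every $v\in V$. For a finite dimensional $\mathfrak{n}$-module $X$ and a simple finite dimensional $\mathfrak{n}$-module $L$ let $[X:L]$ be the multiplicity of $L$ in a composition series of $X$; for a locally finite $\mathfrak{n}$-module $V$ let $[V:L]\in\{0,1,2,\dots,\infty\}$ be the supremum of $[F:L]$ over the finite dimensional $\mathfrak{n}$-submodules $F$ of $V$. Assume that the adjoint $\mathfrak{n}$-module $\mathfrak{g}/\mathfrak{n}$ is locally finite over $\mathfrak{n}$. Let $\mathrm{Irr}$ be the set of isomorphism classes of simple finite dimensional $\mathfrak{n}$-modules, and let $\sim$ be the smallest equivalence relation on $\mathrm{Irr}$ such that, for $L,S\in\mathrm{Irr}$: (I) $L\sim S$ if there is an indecomposable finite dimensional $\mathfrak{n}$-module $X$ with $[X:L]\neq 0$ and $[X:S]\neq 0$; (II) $L\sim S$ if $[\mathfrak{g}/\mathfrak{n}\otimes_{\mathbb{C}}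 L:S]\neq 0$. Let $M$ be a $\mathfrak{g}$-module that is locally finite over $\mathfrak{n}$. For $I\in \mathrm{Irr}/{\sim}$ let $M_I\subseteq M$ be the sum of the images of all $\mathfrak{g}$-homomorphisms $U(\mathfrak{g})\otimes_{U(\mathfrak{n})}N\to M$, where $N$ runs over the finite dimensional $\mathfrak{n}$-modules such that, for every simple finite dimensional $\mathfrak{n}$-module $L$, $[N:L]\neq 0$ implies $L\in I$. Then: (i) For every $I\in \mathrm{Irr}/{\sim}$ the vector space $M_I$ is a $\mathfrak{g}$-submodule of $M$, and for every simple finite dimensional $\mathfrak{n}$-module $L$, $[M_I:L]\neq 0$ implies $L\in I$. (ii) $M=\bigoplus_{I\in \mathrm{Irr}/{\sim}} M_I$. (iii) If $I,J\in \mathrm{Irr}/{\sim}$ and $I\neq J$, then $\mathrm{Hom}_{\mathfrak{g}}(M_I,M_J)=0$. -/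

import Mathlib

open scoped TensorProduct

noncomputable section

namespace LieBlocks

/-! ### Modules over a complex Lie algebra -/

section Modules

variable (𝔨 : Type*) [LieRing 𝔨] [LieAlgebra ℂ 𝔨]

/-- The action of the universal enveloping algebra `U(𝔨)` on a `𝔨`-module. -/
def envAct (V : Type*) [AddCommGroup V] [Module ℂ V] [LieRingModule 𝔨 V] [LieModule ℂ 𝔨 V] :
    UniversalEnvelopingAlgebra ℂ 𝔨 →ₐ[ℂ] Module.End ℂ V :=
  UniversalEnvelopingAlgebra.lift ℂ (LieModule.toEnd ℂ 𝔨 V)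

/-- The subspace `U(𝔨) v` of a `𝔨`-module. -/
def envOrbit {V : Type*} [AddCommGroup V] [Module ℂ V] [LieRingModule 𝔨 V] [LieModule ℂ 𝔨 V]
    (v : V) : Submodule ℂ V :=
  LinearMap.range ((envAct 𝔨 V).toLinearMap.flip v)

/-- The action of `𝔨` on `V` is locally finite: `U(𝔨) v` is finite dimensional for every `v`. -/
def IsLocallyFinite (V : Type*) [AddCommGroup V] [Module ℂ V] [LieRingModule 𝔨 V]
    [LieModule ℂ 𝔨 V] : Prop :=
  ∀ v : V, FiniteDimensional ℂ (envOrbit 𝔨 v)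

/-- A module is indecomposable if it is nonzero and is not the direct sum of two nonzero
submodules. -/
def IsIndecomposable (V : Type*) [AddCommGroup V] [Module ℂ V] [LieRingModule 𝔨 V]
    [LieModule ℂ 𝔨 V] : Prop :=
  Nontrivial V ∧ ∀ A B : LieSubmodule ℂ 𝔨 V, IsCompl A B → A = ⊥ ∨ B = ⊥

/-- The number of factors isomorphic to `L` in the chain `s` of submodules of `V`. -/
def factorCount {V : Type*} [AddCommGroup V] [Module ℂ V] [LieRingModule 𝔨 V] [LieModule ℂ 𝔨 V]
    (s : CompositionSeries (LieSubmodule ℂ 𝔨 V))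
    (L : Type*) [AddCommGroup L] [Module ℂ L] [LieRingModule 𝔨 L] [LieModule ℂ 𝔨 L] : ℕ∞ :=
  Set.encard {i : Fin s.length |
    Nonempty (L ≃ₗ⁅ℂ,𝔨⁆ (s i.succ) ⧸ (s i.castSucc).comap (s i.succ).incl)}

/-- The multiplicity `[X : L]` of a simple module `L` in a finite dimensional module `X`: the
number of factors isomorphic to `L` in a composition series of `X`. (The supremum is over all
composition series of `X`; by the Jordan-Hölder theorem they all give the same value.) -/
def finMult (X : Type*) [AddCommGroup X] [Module ℂ X] [LieRingModule 𝔨 X] [LieModule ℂ 𝔨 X]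
    (L : Type*) [AddCommGroup L] [Module ℂ L] [LieRingModule 𝔨 L] [LieModule ℂ 𝔨 L] : ℕ∞ :=
  ⨆ s : {s : CompositionSeries (LieSubmodule ℂ 𝔨 X) // s.head = ⊥ ∧ s.last = ⊤},
    factorCount 𝔨 s.1 L

/-- The multiplicity `[V : L]` in a locally finite module `V`: the supremum of `[F : L]` over the
finite dimensional submodules `F` of `V`. These are directed, so the supremum may be computed
along any exhausting filtration of `V` by finite dimensional submodules. -/
def mult (V : Type*) [AddCommGroup V] [Module ℂ V] [LieRingModule 𝔨 V] [LieModule ℂ 𝔨 V]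
    (L : Type*) [AddCommGroup L] [Module ℂ L] [LieRingModule 𝔨 L] [LieModule ℂ 𝔨 L] : ℕ∞ :=
  ⨆ F : {F : LieSubmodule ℂ 𝔨 V // FiniteDimensional ℂ F}, finMult 𝔨 F.1 L

/-- Simple finite dimensional `𝔨`-modules. Every finite dimensional complex `𝔨`-module, in
whatever universe, is isomorphic to one whose carrier (for instance `Fin n → ℂ`) is in `Type`. -/
structure SimpleFD where
  carrier : Type
  [addCommGroup : AddCommGroup carrier]
  [module : Module ℂ carrier]
  [lieRingModule : LieRingModule 𝔨 carrier]
  [lieModule : LieModule ℂ 𝔨 carrier]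
  [finiteDimensional : FiniteDimensional ℂ carrier]
  [irreducible : LieModule.IsIrreducible ℂ 𝔨 carrier]

attribute [instance] SimpleFD.addCommGroup SimpleFD.module SimpleFD.lieRingModule
  SimpleFD.lieModule SimpleFD.finiteDimensional SimpleFD.irreducible

/-- Isomorphism of simple finite dimensional modules. -/
instance isoSetoid : Setoid (SimpleFD 𝔨) where
  r L S := Nonempty (L.carrier ≃ₗ⁅ℂ,𝔨⁆ S.carrier)
  iseqv :=
    { refl := fun _ => ⟨LieModuleEquiv.refl⟩
      symm := fun ⟨e⟩ => ⟨e.symm⟩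
      trans := fun ⟨e⟩ ⟨f⟩ => ⟨e.trans f⟩ }

/-- The set of isomorphism classes of simple finite dimensional `𝔨`-modules. -/
def Irr : Type _ := Quotient (isoSetoid 𝔨)

/-- The isomorphism class of a simple finite dimensional module. -/
def SimpleFD.cls {𝔨 : Type*} [LieRing 𝔨] [LieAlgebra ℂ 𝔨] (L : SimpleFD 𝔨) : Irr 𝔨 :=
  Quotient.mk (isoSetoid 𝔨) L

end Modules

/-! ### Induction from a subalgebra -/

section Induction

attribute [local instance 100] LieRing.ofAssociativeRing

variable {𝔤 : Type*} [LieRing 𝔤] [LieAlgebra ℂ 𝔤] (𝔫 : LieSubalgebra ℂ 𝔤)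

/-- The algebra homomorphism `U(𝔫) → U(𝔤)` given by the inclusion of `𝔫` in `𝔤`. -/
def envIncl : UniversalEnvelopingAlgebra ℂ 𝔫 →ₐ[ℂ] UniversalEnvelopingAlgebra ℂ 𝔤 :=
  UniversalEnvelopingAlgebra.lift ℂ ((UniversalEnvelopingAlgebra.ι ℂ).comp 𝔫.incl)

variable (N : Type*) [AddCommGroup N] [Module ℂ N] [LieRingModule 𝔫 N] [LieModule ℂ 𝔫 N]

/-- The `U(𝔤)`-submodule of `U(𝔤) ⊗[ℂ] N` generated by all
`(u w) ⊗ v - u ⊗ (w v)` with `u ∈ U(𝔤)`, `w ∈ U(𝔫)`, `v ∈ N`. -/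
def balancedRel :
    Submodule (UniversalEnvelopingAlgebra ℂ 𝔤) (UniversalEnvelopingAlgebra ℂ 𝔤 ⊗[ℂ] N) :=
  Submodule.span (UniversalEnvelopingAlgebra ℂ 𝔤)
    {t | ∃ (u : UniversalEnvelopingAlgebra ℂ 𝔤) (w : UniversalEnvelopingAlgebra ℂ 𝔫) (v : N),
      t = (u * envIncl 𝔫 w) ⊗ₜ[ℂ] v - u ⊗ₜ[ℂ] (envAct 𝔫 N w v)}

/-- The induced module `U(𝔤) ⊗_{U(𝔫)} N`. -/
abbrev Ind : Type _ := (UniversalEnvelopingAlgebra ℂ 𝔤 ⊗[ℂ] N) ⧸ balancedRel 𝔫 N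

/-- `𝔤` acts on the induced module by left multiplication on `U(𝔤)`. -/
instance Ind.lieRingModule : LieRingModule 𝔤 (Ind 𝔫 N) where
  bracket x m := UniversalEnvelopingAlgebra.ι ℂ x • m
  add_lie x y m := by
    change UniversalEnvelopingAlgebra.ι ℂ (x + y) • m = _ • m + _ • m
    rw [map_add, add_smul]
  lie_add x m n := smul_add _ m n
  leibniz_lie x y m := by
    change UniversalEnvelopingAlgebra.ι ℂ x • UniversalEnvelopingAlgebra.ι ℂ y • m
      = UniversalEnvelopingAlgebra.ι ℂ ⁅x, y⁆ • m
        + UniversalEnvelopingAlgebra.ι ℂ y • UniversalEnvelopingAlgebra.ι ℂ x • m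
    rw [LieHom.map_lie, LieRing.of_associative_ring_bracket, sub_smul, mul_smul, mul_smul]
    abel

instance Ind.lieModule : LieModule ℂ 𝔤 (Ind 𝔫 N) where
  smul_lie c x m := by
    change UniversalEnvelopingAlgebra.ι ℂ (c • x) • m = c • UniversalEnvelopingAlgebra.ι ℂ x • m
    rw [map_smul, smul_assoc]
  lie_smul c x m := by
    change UniversalEnvelopingAlgebra.ι ℂ x • c • m = c • UniversalEnvelopingAlgebra.ι ℂ x • m
    rw [smul_comm]

end Induction

/-! ### The equivalence relation and the traces -/

section Blocks

variable {𝔤 : Type*} [LieRing 𝔤] [LieAlgebra ℂ 𝔤] (𝔫 : LieSubalgebra ℂ 𝔤)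

/-- The adjoint `𝔫`-module `𝔤/𝔫`. -/
abbrev AdjQuot : Type _ := 𝔤 ⧸ 𝔫.toLieSubmodule

/-- The first generating relation: `L` and `S` both occur in some indecomposable finite
dimensional `𝔫`-module. -/
def ShareIndecomposable (L S : SimpleFD 𝔫) : Prop :=
  ∃ (X : Type) (_ : AddCommGroup X) (_ : Module ℂ X) (_ : LieRingModule 𝔫 X)
    (_ : LieModule ℂ 𝔫 X), FiniteDimensional ℂ X ∧ IsIndecomposable 𝔫 X ∧
      finMult 𝔫 X L.carrier ≠ 0 ∧ finMult 𝔫 X S.carrier ≠ 0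

/-- The second generating relation: `[𝔤/𝔫 ⊗ L : S] ≠ 0`. -/
def OccursInTensor (L S : SimpleFD 𝔫) : Prop :=
  mult 𝔫 (AdjQuot 𝔫 ⊗[ℂ] L.carrier) S.carrier ≠ 0

/-- The union of the two generating relations, on isomorphism classes. -/
def Linked (a b : Irr 𝔫) : Prop :=
  ∃ L S : SimpleFD 𝔫, L.cls = a ∧ S.cls = b ∧ (ShareIndecomposable 𝔫 L S ∨ OccursInTensor 𝔫 L S)

/-- The smallest equivalence relation on `Irr 𝔫` containing both generating relations. -/
def blockSetoid : Setoid (Irr 𝔫) := Relation.EqvGen.setoid (Linked 𝔫)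

/-- The set of equivalence classes of simple finite dimensional `𝔫`-modules. -/
def Block : Type _ := Quotient (blockSetoid 𝔫)

/-- `L ∈ I`, for a simple finite dimensional `𝔫`-module `L` (in any universe): the isomorphism
class of `L` belongs to the equivalence class `I`. -/
def Belongs (L : Type*) [AddCommGroup L] [Module ℂ L] [LieRingModule 𝔫 L] [LieModule ℂ 𝔫 L]
    (I : Block 𝔫) : Prop :=
  ∃ S : SimpleFD 𝔫, Nonempty (L ≃ₗ⁅ℂ,𝔫⁆ S.carrier) ∧ Quotient.mk (blockSetoid 𝔫) S.cls = I

/-- A finite dimensional `𝔫`-module `N` such that `[N : L] ≠ 0` implies `L ∈ I`. -/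
def HasFactorsIn (N : Type) [AddCommGroup N] [Module ℂ N] [LieRingModule 𝔫 N] [LieModule ℂ 𝔫 N]
    (I : Block 𝔫) : Prop :=
  FiniteDimensional ℂ N ∧
    ∀ L : SimpleFD 𝔫, finMult 𝔫 N L.carrier ≠ 0 → Belongs 𝔫 L.carrier I

/-- The subspace `M_I`: the sum of the images of all `𝔤`-homomorphisms to `M` from the modules
induced from finite dimensional `𝔫`-modules with all composition factors in `I`. -/
def traceSubspace (M : Type*) [AddCommGroup M] [Module ℂ M] [LieRingModule 𝔤 M] [LieModule ℂ 𝔤 M]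
    (I : Block 𝔫) : Submodule ℂ M :=
  ⨆ (N : Type) (_ : AddCommGroup N) (_ : Module ℂ N) (_ : LieRingModule 𝔫 N)
    (_ : LieModule ℂ 𝔫 N) (_ : HasFactorsIn 𝔫 N I) (φ : Ind 𝔫 N →ₗ⁅ℂ,𝔤⁆ M),
    LinearMap.range (φ : Ind 𝔫 N →ₗ[ℂ] M)

end Blocks

end LieBlocks

end

/-!
For simple `L`, `[X : L] ≠ 0` says that `L` is a subquotient of `X`, and a simple subquotient of
an extension is a subquotient of one of its two ends. Hence, for every set of isomorphism classes
of simple modules, each module has a largest submodule, its component, with all simple finite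
dimensional subquotients in this set; in a locally finite module the components of disjoint sets
are disjoint. By (I) the composition factors of a finite dimensional indecomposable module lie in
a single block, so the components of the blocks span every locally finite module.

The component of a block `I` in `M` is stable under `𝔤`: if `F` is a finite dimensional
`𝔫`-submodule of it, then `x ⊗ v ↦ x v` defines an `𝔫`-homomorphism `𝔤/𝔫 ⊗ F → M/F`, so by (II)
the simple subquotients of `F + 𝔤 F` again lie in `I`. By the universal property of induction it
is therefore `M_I`, and the image of a `𝔤`-homomorphism `M_I → M_J` lies in the components of both
`I` and `J`, hence is zero if `I ≠ J`.
-/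

namespace LieBlocks

section LieModules

variable {R 𝔨 L X Y Z : Type*} [CommRing R] [LieRing 𝔨]
  [AddCommGroup L] [Module R L] [LieRingModule 𝔨 L]
  [AddCommGroup X] [Module R X] [LieRingModule 𝔨 X]
  [AddCommGroup Y] [Module R Y] [LieRingModule 𝔨 Y]
  [AddCommGroup Z] [Module R Z] [LieRingModule 𝔨 Z]

/-- A homomorphism of Lie modules, as a map onto its range. -/
def rangeRestrict (f : X →ₗ⁅R,𝔨⁆ Y) : X →ₗ⁅R,𝔨⁆ f.range :=
  f.codRestrict f.range fun x => (f.mem_range _).2 ⟨x, rfl⟩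

theorem surjective_rangeRestrict (f : X →ₗ⁅R,𝔨⁆ Y) : Function.Surjective (rangeRestrict f) := by
  rintro ⟨y, hy⟩
  obtain ⟨x, rfl⟩ := (f.mem_range y).1 hy
  exact ⟨x, rfl⟩

/-- The restriction of a homomorphism of Lie modules to the preimage of a submodule. -/
def comapRestrict (f : X →ₗ⁅R,𝔨⁆ Y) (A : LieSubmodule R 𝔨 Y) : A.comap f →ₗ⁅R,𝔨⁆ A :=
  (f.comp (A.comap f).incl).codRestrict A fun x => x.2

theorem exists_comp_eq_of_ker_le (g : X →ₗ⁅R,𝔨⁆ Z) (hg : Function.Surjective g)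
    (f : X →ₗ⁅R,𝔨⁆ L) (h : g.ker ≤ f.ker) : ∃ f' : Z →ₗ⁅R,𝔨⁆ L, ∀ x, f' (g x) = f x := by
  obtain ⟨s, hs⟩ := hg.hasRightInverse
  have hfs (x : X) : f (s (g x)) = f x := by
    refine sub_eq_zero.1 ?_
    rw [← map_sub]
    exact h (by rw [LieModuleHom.mem_ker, map_sub, hs, sub_self])
  exact ⟨{
    toFun z := f (s z)
    map_add' := hg.forall₂.2 fun x y => by rw [← map_add, hfs, hfs, hfs, map_add]
    map_smul' c := hg.forall.2 fun x => by rw [← map_smul, hfs, hfs, map_smul, RingHom.id_apply]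
    map_lie' {y z} := by
      obtain ⟨x, rfl⟩ := hg z
      rw [← LieModuleHom.map_lie, hfs, hfs, LieModuleHom.map_lie] }, hfs⟩

theorem surjective_of_apply_ne_zero [LieModule.IsIrreducible R 𝔨 L] (f : X →ₗ⁅R,𝔨⁆ L) {x : X}
    (hx : f x ≠ 0) : Function.Surjective f := by
  refine f.range_eq_top.1 ((eq_bot_or_eq_top f.range).resolve_left fun h => hx ?_)
  rw [← LieSubmodule.mem_bot (R := R) (L := 𝔨), ← h, LieModuleHom.mem_range]
  exact ⟨x, rfl⟩

theorem isCoatom_ker [LieModule.IsIrreducible R 𝔨 L] (f : X →ₗ⁅R,𝔨⁆ L)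
    (hf : Function.Surjective f) : IsCoatom f.ker := by
  refine ⟨fun h => ?_, fun C hC => ?_⟩
  · have := LieModule.nontrivial_of_isIrreducible R 𝔨 L
    obtain ⟨l, hl⟩ := exists_ne (0 : L)
    obtain ⟨x, rfl⟩ := hf l
    exact hl (LieModuleHom.mem_ker.1 (h ▸ LieSubmodule.mem_top x))
  · have hmap : C.map f = ⊤ := (eq_bot_or_eq_top _).resolve_left fun h =>
      hC.not_ge ((LieModuleHom.le_ker_iff_map C).2 h)
    refine eq_top_iff.2 fun x _ => ?_
    obtain ⟨c, hc, hcx⟩ := (LieSubmodule.mem_map _).1 (hmap ▸ LieSubmodule.mem_top (f x))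
    have hxc : x - c ∈ f.ker := by rw [LieModuleHom.mem_ker, map_sub, hcx, sub_self]
    simpa only [sub_add_cancel] using add_mem (hC.le hxc) hc

theorem map_incl_covBy_of_isCoatom {A : LieSubmodule R 𝔨 X} {K : LieSubmodule R 𝔨 A}
    (hK : IsCoatom K) : K.map A.incl ⋖ A := by
  suffices h : K.map A.incl ⋖ (⊤ : LieSubmodule R 𝔨 A).map A.incl by
    rwa [LieSubmodule.map_incl_top] at h
  refine hK.covBy_top.image (LieSubmodule.mapOrderEmbedding A.injective_incl) ⟨?_⟩
  rintro _ - _ ⟨B, rfl⟩ C ⟨-, hCB⟩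
  have hCA : C ≤ A := hCB.trans LieSubmodule.map_incl_le
  exact ⟨C.comap A.incl, (LieSubmodule.map_comap_incl A C).trans (inf_eq_right.2 hCA)⟩

theorem isIrreducible_congr (e : X ≃ₗ⁅R,𝔨⁆ Y) [LieModule.IsIrreducible R 𝔨 X] :
    LieModule.IsIrreducible R 𝔨 Y :=
  (LieSubmodule.orderIsoMapComap e).symm.isSimpleOrder

theorem isIrreducible_of_isAtom {A : LieSubmodule R 𝔨 X} (hA : IsAtom A) :
    LieModule.IsIrreducible R 𝔨 A := by
  have : Nontrivial A := (LieSubmodule.nontrivial_iff_ne_bot R 𝔨 X).2 hA.1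
  refine LieModule.IsIrreducible.mk fun N hN => ?_
  have hinj := LieSubmodule.map_injective_of_injective A.injective_incl
  have hmap : N.map A.incl = A := (hA.le_iff.1 LieSubmodule.map_incl_le).resolve_left fun h =>
    hN (hinj (h.trans LieSubmodule.map_bot.symm))
  exact hinj (hmap.trans (LieSubmodule.map_incl_top A).symm)

theorem nonempty_equiv_quotient_ker [LieAlgebra R 𝔨] [LieModule R 𝔨 X] (f : X →ₗ⁅R,𝔨⁆ L)
    (hf : Function.Surjective f) : Nonempty (L ≃ₗ⁅R,𝔨⁆ X ⧸ f.ker) := by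
  obtain ⟨q, hq⟩ := exists_comp_eq_of_ker_le f hf (LieSubmodule.Quotient.mk' f.ker)
    (LieSubmodule.Quotient.mk'_ker f.ker).ge
  refine ⟨{ q, LinearEquiv.ofBijective (q : L →ₗ[R] X ⧸ f.ker) ⟨?_, ?_⟩ with }⟩
  · refine (injective_iff_map_eq_zero (q : L →ₗ[R] X ⧸ f.ker)).2 (hf.forall.2 fun x hx => ?_)
    exact LieModuleHom.mem_ker.1 ((LieSubmodule.Quotient.mk_eq_zero f.ker).1 ((hq x).symm.trans hx))
  · refine (LieSubmodule.Quotient.surjective_mk' f.ker).forall.2 fun x => ⟨f x, hq x⟩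

end LieModules

theorem exists_compositionSeries_of_covBy {α : Type*} [Lattice α] [IsModularLattice α]
    [BoundedOrder α] [WellFoundedLT α] [WellFoundedGT α] {a b : α} (h : a ⋖ b) :
    ∃ s : CompositionSeries α, s.head = ⊥ ∧ s.last = ⊤ ∧
      ∃ i : Fin s.length, s i.castSucc = a ∧ s i.succ = b := by
  let u : LTSeries α := (RelSeries.singleton _ a).snoc b h.lt
  obtain ⟨s, j, hj, hbot, htop⟩ := u.exists_relSeries_covBy_and_head_eq_bot_and_last_eq_bot
  let s' : CompositionSeries α := s
  have ha : s' (j 0) = a := congrFun hj 0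
  have hb : s' (j 1) = b := congrFun hj 1
  have hlt : j 0 < j 1 := s'.strictMono.lt_iff_lt.1 (by rw [ha, hb]; exact h.lt)
  let i : Fin s'.length := ⟨j 0, (Fin.lt_def.1 hlt).trans_le (Nat.lt_succ_iff.1 (j 1).2)⟩
  have hi : s' i.castSucc < s' i.succ := s'.lt_succ i
  have hle : s' i.succ ≤ b := hb ▸ s'.strictMono.monotone (Fin.le_def.2 hlt)
  rw [show s' i.castSucc = a from ha] at hi
  exact ⟨s', hbot, htop, i, ha, (h.eq_or_eq hi.le hle).resolve_left hi.ne'⟩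

section Subquotients

variable {R 𝔨 L L' X Y Z W : Type*} [CommRing R] [LieRing 𝔨]
  [AddCommGroup L] [Module R L] [LieRingModule 𝔨 L]
  [AddCommGroup L'] [Module R L'] [LieRingModule 𝔨 L']
  [AddCommGroup X] [Module R X] [LieRingModule 𝔨 X]
  [AddCommGroup Y] [Module R Y] [LieRingModule 𝔨 Y]
  [AddCommGroup Z] [Module R Z] [LieRingModule 𝔨 Z]
  [AddCommGroup W] [Module R W] [LieRingModule 𝔨 W]

variable (R 𝔨 L X) in
/-- `L` is a subquotient of `X`: a quotient of a submodule of `X`, up to isomorphism. For simple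
`L`, this is the form in which `[X : L] ≠ 0` is used. -/
def IsSubquotient : Prop :=
  ∃ (A : LieSubmodule R 𝔨 X) (f : A →ₗ⁅R,𝔨⁆ L), Function.Surjective f

variable (R 𝔨 L) in
theorem IsSubquotient.refl : IsSubquotient R 𝔨 L L :=
  ⟨⊤, (⊤ : LieSubmodule R 𝔨 L).incl, fun l => ⟨⟨l, LieSubmodule.mem_top l⟩, rfl⟩⟩

theorem IsSubquotient.congr_left (e : L ≃ₗ⁅R,𝔨⁆ L') :
    IsSubquotient R 𝔨 L X → IsSubquotient R 𝔨 L' X :=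
  fun ⟨A, f, hf⟩ => ⟨A, e.toLieModuleHom.comp f, e.surjective.comp hf⟩

theorem IsSubquotient.of_surjective (g : X →ₗ⁅R,𝔨⁆ Y) (hg : Function.Surjective g) :
    IsSubquotient R 𝔨 L Y → IsSubquotient R 𝔨 L X := by
  rintro ⟨A, f, hf⟩
  refine ⟨A.comap g, f.comp (comapRestrict g A), hf.comp ?_⟩
  rintro ⟨y, hy⟩
  obtain ⟨x, rfl⟩ := hg y
  exact ⟨⟨x, hy⟩, rfl⟩

theorem IsSubquotient.of_injective (g : X →ₗ⁅R,𝔨⁆ Y) (hg : Function.Injective g) :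
    IsSubquotient R 𝔨 L X → IsSubquotient R 𝔨 L Y := by
  rintro ⟨A, f, hf⟩
  let h := g.comp A.incl
  have hker : (rangeRestrict h).ker ≤ f.ker := fun a ha => by
    have ha : h a = 0 := congrArg Subtype.val (LieModuleHom.mem_ker.1 ha)
    rw [(hg.comp A.injective_incl) (ha.trans (map_zero h).symm)]
    exact zero_mem _
  obtain ⟨f', hf'⟩ := exists_comp_eq_of_ker_le _ (surjective_rangeRestrict h) f hker
  refine ⟨h.range, f', fun l => ?_⟩
  obtain ⟨a, rfl⟩ := hf l
  exact ⟨_, hf' a⟩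

theorem IsSubquotient.of_submodule {A : LieSubmodule R 𝔨 X} :
    IsSubquotient R 𝔨 L A → IsSubquotient R 𝔨 L X :=
  .of_injective A.incl A.injective_incl

theorem IsSubquotient.mono {A B : LieSubmodule R 𝔨 X} (hAB : A ≤ B) :
    IsSubquotient R 𝔨 L A → IsSubquotient R 𝔨 L B :=
  .of_injective (LieSubmodule.inclusion hAB) (LieSubmodule.inclusion_injective hAB)

theorem IsSubquotient.of_range (g : X →ₗ⁅R,𝔨⁆ Y) :
    IsSubquotient R 𝔨 L g.range → IsSubquotient R 𝔨 L X :=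
  .of_surjective _ (surjective_rangeRestrict g)

theorem IsSubquotient.nontrivial [Nontrivial L] : IsSubquotient R 𝔨 L X → Nontrivial X :=
  fun ⟨A, _, hf⟩ => have := hf.nontrivial; A.injective_incl.nontrivial

variable [LieModule.IsIrreducible R 𝔨 L]

theorem isSubquotient_of_apply_ne_zero (i : X →ₗ⁅R,𝔨⁆ Y) {A : LieSubmodule R 𝔨 Y}
    (f : A →ₗ⁅R,𝔨⁆ L) {x : X} (hx : i x ∈ A) (hfx : f ⟨i x, hx⟩ ≠ 0) : IsSubquotient R 𝔨 L X :=
  ⟨A.comap i, f.comp (comapRestrict i A), surjective_of_apply_ne_zero _ (x := ⟨x, hx⟩) hfx⟩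

theorem IsSubquotient.ker_or_range (g : Y →ₗ⁅R,𝔨⁆ Z) (h : IsSubquotient R 𝔨 L Y) :
    IsSubquotient R 𝔨 L g.ker ∨ IsSubquotient R 𝔨 L g.range := by
  obtain ⟨A, f, hf⟩ := h
  let q := (rangeRestrict g).comp A.incl
  by_cases hker : (rangeRestrict q).ker ≤ f.ker
  · right
    obtain ⟨f', hf'⟩ := exists_comp_eq_of_ker_le _ (surjective_rangeRestrict q) f hker
    refine ⟨q.range, f', fun l => ?_⟩
    obtain ⟨a, rfl⟩ := hf l
    exact ⟨_, hf' a⟩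
  · left
    obtain ⟨a, ha, hfa⟩ := SetLike.not_le_iff_exists.1 hker
    have hga : g a = 0 :=
      congrArg (fun z : q.range => ((z : g.range) : Z)) (LieModuleHom.mem_ker.1 ha)
    exact isSubquotient_of_apply_ne_zero g.ker.incl f (x := ⟨a, LieModuleHom.mem_ker.2 hga⟩) a.2
      fun h => hfa (LieModuleHom.mem_ker.2 h)

theorem IsSubquotient.of_exact (i : X →ₗ⁅R,𝔨⁆ Y) (g : Y →ₗ⁅R,𝔨⁆ W) (g' : Z →ₗ⁅R,𝔨⁆ W)
    (hi : g.ker ≤ i.range) (hg : g.range ≤ g'.range) (h : IsSubquotient R 𝔨 L Y) :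
    IsSubquotient R 𝔨 L X ∨ IsSubquotient R 𝔨 L Z :=
  (h.ker_or_range g).imp (fun h => (h.mono hi).of_range) fun h => (h.mono hg).of_range

theorem IsSubquotient.of_sup [LieAlgebra R 𝔨] [LieModule R 𝔨 X] {A B : LieSubmodule R 𝔨 X}
    (h : IsSubquotient R 𝔨 L ↥(A ⊔ B)) : IsSubquotient R 𝔨 L A ∨ IsSubquotient R 𝔨 L B := by
  let q := LieSubmodule.Quotient.mk' A
  refine h.of_exact (LieSubmodule.inclusion le_sup_left) (q.comp (A ⊔ B).incl) (q.comp B.incl) ?_ ?_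
  · intro y hy
    exact (LieModuleHom.mem_range _ _).2 ⟨⟨y, (LieSubmodule.Quotient.mk_eq_zero A).1 hy⟩, rfl⟩
  · intro w hw
    obtain ⟨⟨y, hy⟩, rfl⟩ := (LieModuleHom.mem_range _ _).1 hw
    obtain ⟨a, ha, b, hb, rfl⟩ := (LieSubmodule.mem_sup _ _ _).1 hy
    have hqa : q a = 0 := (LieSubmodule.Quotient.mk_eq_zero A).2 ha
    refine (LieModuleHom.mem_range _ _).2 ⟨⟨b, hb⟩, ?_⟩
    change q b = q (a + b)
    rw [map_add, hqa, zero_add]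

theorem IsSubquotient.exists_of_cover {p : LieSubmodule R 𝔨 X → Prop}
    (hp : ∀ x, ∃ F, p F ∧ x ∈ F) (h : IsSubquotient R 𝔨 L X) :
    ∃ F, p F ∧ IsSubquotient R 𝔨 L F := by
  obtain ⟨A, f, hf⟩ := h
  have := LieModule.nontrivial_of_isIrreducible R 𝔨 L
  obtain ⟨l, hl⟩ := exists_ne (0 : L)
  obtain ⟨a, rfl⟩ := hf l
  obtain ⟨F, hF, ha⟩ := hp a
  exact ⟨F, hF, isSubquotient_of_apply_ne_zero F.incl f (x := ⟨a, ha⟩) a.2 hl⟩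

end Subquotients

section EnvelopingAlgebra

attribute [local instance 100] LieRing.ofAssociativeRing

open UniversalEnvelopingAlgebra (ι lift)

theorem envelopingAlgebra_induction {R 𝔨 : Type*} [CommRing R] [LieRing 𝔨] [LieAlgebra R 𝔨]
    {p : UniversalEnvelopingAlgebra R 𝔨 → Prop} (hι : ∀ x, p (ι R x))
    (halgebraMap : ∀ c, p (algebraMap R _ c)) (hadd : ∀ u w, p u → p w → p (u + w))
    (hmul : ∀ u w, p u → p w → p (u * w)) (u : UniversalEnvelopingAlgebra R 𝔨) : p u := by
  let S : Subalgebra R (UniversalEnvelopingAlgebra R 𝔨) :=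
    { carrier := {u | p u}
      mul_mem' := hmul _ _
      add_mem' := hadd _ _
      algebraMap_mem' := halgebraMap }
  let j : 𝔨 →ₗ⁅R⁆ S :=
    { toFun x := ⟨ι R x, hι x⟩
      map_add' x y := Subtype.ext (map_add _ x y)
      map_smul' c x := Subtype.ext (map_smul _ c x)
      map_lie' {x y} := Subtype.ext (LieHom.map_lie _ x y) }
  have hid : S.val.comp (lift R j) = AlgHom.id R _ := by
    apply UniversalEnvelopingAlgebra.hom_ext R
    ext x
    simp [j]
  have hu : ((lift R j u : S) : UniversalEnvelopingAlgebra R 𝔨) = u := DFunLike.congr_fun hid u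
  exact hu ▸ (lift R j u).2

variable {𝔨 X Y : Type*} [LieRing 𝔨] [LieAlgebra ℂ 𝔨]
  [AddCommGroup X] [Module ℂ X] [LieRingModule 𝔨 X] [LieModule ℂ 𝔨 X]
  [AddCommGroup Y] [Module ℂ Y] [LieRingModule 𝔨 Y] [LieModule ℂ 𝔨 Y]

theorem envAct_ι (x : 𝔨) (v : X) : envAct 𝔨 X (ι ℂ x) v = ⁅x, v⁆ := by
  rw [envAct, UniversalEnvelopingAlgebra.lift_ι_apply, LieModule.toEnd_apply_apply]

theorem envAct_mem {F : LieSubmodule ℂ 𝔨 X} (u : UniversalEnvelopingAlgebra ℂ 𝔨) {v : X}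
    (hv : v ∈ F) : envAct 𝔨 X u v ∈ F := by
  induction u using envelopingAlgebra_induction generalizing v with
  | hι x => exact envAct_ι x v ▸ F.lie_mem hv
  | halgebraMap c =>
    rw [AlgHom.commutes, Module.algebraMap_end_apply]
    exact F.smul_mem c hv
  | hadd u w hu hw =>
    rw [map_add, LinearMap.add_apply]
    exact add_mem (hu hv) (hw hv)
  | hmul u w hu hw =>
    rw [map_mul, Module.End.mul_apply]
    exact hu (hw hv)

theorem map_envAct (f : X →ₗ⁅ℂ,𝔨⁆ Y) (u : UniversalEnvelopingAlgebra ℂ 𝔨) (v : X) :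
    f (envAct 𝔨 X u v) = envAct 𝔨 Y u (f v) := by
  induction u using envelopingAlgebra_induction generalizing v with
  | hι x => rw [envAct_ι, envAct_ι, LieModuleHom.map_lie]
  | halgebraMap c =>
    rw [AlgHom.commutes, AlgHom.commutes, Module.algebraMap_end_apply,
      Module.algebraMap_end_apply, map_smul]
  | hadd u w hu hw =>
    rw [map_add, map_add, LinearMap.add_apply, LinearMap.add_apply, map_add, hu, hw]
  | hmul u w hu hw =>
    rw [map_mul, map_mul, Module.End.mul_apply, Module.End.mul_apply, hu, hw]

end EnvelopingAlgebra

section LocallyFinite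

variable {𝔨 X Y : Type*} [LieRing 𝔨] [LieAlgebra ℂ 𝔨]
  [AddCommGroup X] [Module ℂ X] [LieRingModule 𝔨 X] [LieModule ℂ 𝔨 X]
  [AddCommGroup Y] [Module ℂ Y] [LieRingModule 𝔨 Y] [LieModule ℂ 𝔨 Y]

theorem isLocallyFinite_iff : IsLocallyFinite 𝔨 X ↔
    ∀ x : X, ∃ F : LieSubmodule ℂ 𝔨 X, FiniteDimensional ℂ F ∧ x ∈ F := by
  refine ⟨fun h x => ?_, fun h x => ?_⟩
  · refine ⟨{ envOrbit 𝔨 x with lie_mem := ?_ }, h x, 1, by simp⟩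
    rintro y _ ⟨u, rfl⟩
    exact ⟨UniversalEnvelopingAlgebra.ι ℂ y * u, by simp [envAct]⟩
  · obtain ⟨F, hF, hx⟩ := h x
    have hle : envOrbit 𝔨 x ≤ F.toSubmodule := by
      rintro _ ⟨u, rfl⟩
      exact envAct_mem u hx
    exact Submodule.finiteDimensional_of_le (S₂ := F.toSubmodule) hle

theorem IsLocallyFinite.exists_finiteDimensional_le (hX : IsLocallyFinite 𝔨 X)
    {A : LieSubmodule ℂ 𝔨 X} {x : X} (hx : x ∈ A) :
    ∃ F ≤ A, FiniteDimensional ℂ F ∧ x ∈ F := by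
  obtain ⟨E, _, hxE⟩ := isLocallyFinite_iff.1 hX x
  exact ⟨E ⊓ A, inf_le_right, Submodule.finiteDimensional_of_le
    (inf_le_left : E.toSubmodule ⊓ A.toSubmodule ≤ E.toSubmodule), hxE, hx⟩

theorem isLocallyFinite_of_finiteDimensional [FiniteDimensional ℂ X] : IsLocallyFinite 𝔨 X :=
  fun _ => FiniteDimensional.finiteDimensional_submodule _

theorem IsLocallyFinite.tensorProduct (hX : IsLocallyFinite 𝔨 X) (hY : IsLocallyFinite 𝔨 Y) :
    IsLocallyFinite 𝔨 (X ⊗[ℂ] Y) := by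
  refine isLocallyFinite_iff.2 fun t => ?_
  induction t with
  | zero => exact ⟨⊥, inferInstanceAs (FiniteDimensional ℂ (⊥ : Submodule ℂ _)), zero_mem _⟩
  | tmul x y =>
    obtain ⟨A, _, hx⟩ := isLocallyFinite_iff.1 hX x
    obtain ⟨B, _, hy⟩ := isLocallyFinite_iff.1 hY y
    let g : A ⊗[ℂ] B →ₗ⁅ℂ,𝔨⁆ X ⊗[ℂ] Y := TensorProduct.LieModule.mapIncl A B
    refine ⟨g.range, ?_, (LieModuleHom.mem_range _ _).2 ⟨⟨x, hx⟩ ⊗ₜ ⟨y, hy⟩, rfl⟩⟩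
    exact Module.Finite.of_surjective (rangeRestrict g : A ⊗[ℂ] B →ₗ[ℂ] g.range)
      (surjective_rangeRestrict g)
  | add s t hs ht =>
    obtain ⟨A, hA, hsA⟩ := hs
    obtain ⟨B, hB, htB⟩ := ht
    refine ⟨A ⊔ B, ?_, add_mem (le_sup_left (a := A) hsA) (le_sup_right (b := B) htB)⟩
    change FiniteDimensional ℂ (A ⊔ B).toSubmodule
    rw [LieSubmodule.sup_toSubmodule]
    change FiniteDimensional ℂ A.toSubmodule at hA
    change FiniteDimensional ℂ B.toSubmodule at hB
    infer_instance

end LocallyFinite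

section Multiplicities

variable {𝔨 L X : Type*} [LieRing 𝔨] [LieAlgebra ℂ 𝔨]
  [AddCommGroup L] [Module ℂ L] [LieRingModule 𝔨 L] [LieModule ℂ 𝔨 L]
  [AddCommGroup X] [Module ℂ X] [LieRingModule 𝔨 X] [LieModule ℂ 𝔨 X]

theorem finMult_ne_zero_iff : finMult 𝔨 X L ≠ 0 ↔
    ∃ s : CompositionSeries (LieSubmodule ℂ 𝔨 X), (s.head = ⊥ ∧ s.last = ⊤) ∧
      ∃ i : Fin s.length,
        Nonempty (L ≃ₗ⁅ℂ,𝔨⁆ s i.succ ⧸ (s i.castSucc).comap (s i.succ).incl) := by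
  rw [finMult, ← bot_eq_zero, ne_eq, iSup_eq_bot, not_forall, Subtype.exists]
  simp only [exists_prop]
  exact exists_congr fun s => and_congr_right fun _ => Set.encard_ne_zero

theorem mult_ne_zero_iff : mult 𝔨 X L ≠ 0 ↔
    ∃ F : LieSubmodule ℂ 𝔨 X, FiniteDimensional ℂ F ∧ finMult 𝔨 F L ≠ 0 := by
  rw [mult, ← bot_eq_zero, ne_eq, iSup_eq_bot, not_forall]
  exact ⟨fun ⟨⟨F, hF⟩, h⟩ => ⟨F, hF, h⟩, fun ⟨F, hF, h⟩ => ⟨⟨F, hF⟩, h⟩⟩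

theorem isSubquotient_of_finMult_ne_zero (h : finMult 𝔨 X L ≠ 0) : IsSubquotient ℂ 𝔨 L X := by
  obtain ⟨s, -, i, ⟨e⟩⟩ := finMult_ne_zero_iff.1 h
  exact ((IsSubquotient.refl ℂ 𝔨 L).of_injective e.toLieModuleHom e.injective
    |>.of_surjective _ (LieSubmodule.Quotient.surjective_mk' _)).of_submodule

theorem isSubquotient_of_mult_ne_zero (h : mult 𝔨 X L ≠ 0) : IsSubquotient ℂ 𝔨 L X := by
  obtain ⟨F, -, hF⟩ := mult_ne_zero_iff.1 h
  exact (isSubquotient_of_finMult_ne_zero hF).of_submodule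

variable [LieModule.IsIrreducible ℂ 𝔨 L]

theorem IsSubquotient.finMult_ne_zero [FiniteDimensional ℂ X] (h : IsSubquotient ℂ 𝔨 L X) :
    finMult 𝔨 X L ≠ 0 := by
  obtain ⟨A, f, hf⟩ := h
  have := LieSubmodule.wellFoundedLT_of_isArtinian ℂ 𝔨 X
  obtain ⟨s, hbot, htop, i, hK, hA⟩ :=
    exists_compositionSeries_of_covBy (map_incl_covBy_of_isCoatom (isCoatom_ker f hf))
  refine finMult_ne_zero_iff.2 ⟨s, ⟨hbot, htop⟩, i, ?_⟩
  rw [hK, hA, LieSubmodule.comap_map_eq _ _ A.ker_incl]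
  exact nonempty_equiv_quotient_ker f hf

theorem IsSubquotient.mult_ne_zero (hX : IsLocallyFinite 𝔨 X) (h : IsSubquotient ℂ 𝔨 L X) :
    mult 𝔨 X L ≠ 0 := by
  obtain ⟨F, _, hL⟩ := h.exists_of_cover (isLocallyFinite_iff.1 hX)
  exact mult_ne_zero_iff.2 ⟨F, ‹_›, hL.finMult_ne_zero⟩

end Multiplicities

section SimpleModules

attribute [local instance 100] LieRing.ofAssociativeRing

variable {𝔨 X : Type*} [LieRing 𝔨] [LieAlgebra ℂ 𝔨]
  [AddCommGroup X] [Module ℂ X] [LieRingModule 𝔨 X] [LieModule ℂ 𝔨 X] [FiniteDimensional ℂ X]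

variable (𝔨 X)

theorem exists_equiv_type :
    ∃ (Y : Type) (_ : AddCommGroup Y) (_ : Module ℂ Y) (_ : LieRingModule 𝔨 Y)
      (_ : LieModule ℂ 𝔨 Y), FiniteDimensional ℂ Y ∧ Nonempty (X ≃ₗ⁅ℂ,𝔨⁆ Y) := by
  let e : X ≃ₗ[ℂ] Fin (Module.finrank ℂ X) → ℂ := (Module.finBasis ℂ X).equivFun
  let ρ := e.lieConj.toLieHom.comp (LieModule.toEnd ℂ 𝔨 X)
  let : LieRingModule 𝔨 (Fin (Module.finrank ℂ X) → ℂ) := LieRingModule.compLieHom _ ρ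
  refine ⟨_, _, _, _, LieModule.compLieHom _ ρ, inferInstance,
    ⟨{ e with map_lie' := fun {y x} => ?_ }⟩⟩
  change e ⁅y, x⁆ = e ⁅y, e.symm (e x)⁆
  rw [e.symm_apply_apply]

theorem exists_simpleFD_equiv [LieModule.IsIrreducible ℂ 𝔨 X] :
    ∃ S : SimpleFD 𝔨, Nonempty (X ≃ₗ⁅ℂ,𝔨⁆ S.carrier) := by
  obtain ⟨Y, _, _, _, _, _, ⟨e⟩⟩ := exists_equiv_type 𝔨 X
  have := isIrreducible_congr e
  exact ⟨⟨Y⟩, ⟨e⟩⟩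

theorem exists_simpleFD_injective [Nontrivial X] :
    ∃ (S : SimpleFD 𝔨) (f : S.carrier →ₗ⁅ℂ,𝔨⁆ X), Function.Injective f := by
  have : Nontrivial (LieSubmodule ℂ 𝔨 X) := (LieSubmodule.nontrivial_iff ℂ 𝔨 X).2 inferInstance
  have := LieSubmodule.wellFoundedLT_of_isArtinian ℂ 𝔨 X
  obtain ⟨A, hA, -⟩ := (eq_bot_or_exists_atom_le (⊤ : LieSubmodule ℂ 𝔨 X)).resolve_left top_ne_bot
  have := isIrreducible_of_isAtom hA
  obtain ⟨S, ⟨e⟩⟩ := exists_simpleFD_equiv 𝔨 A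
  exact ⟨S, A.incl.comp e.symm.toLieModuleHom, A.injective_incl.comp e.symm.injective⟩

theorem exists_simpleFD_isSubquotient [Nontrivial X] :
    ∃ S : SimpleFD 𝔨, IsSubquotient ℂ 𝔨 S.carrier X :=
  (exists_simpleFD_injective 𝔨 X).imp fun S ⟨f, hf⟩ =>
    (IsSubquotient.refl ℂ 𝔨 S.carrier).of_injective f hf

end SimpleModules

section Components

variable {𝔨 : Type*} [LieRing 𝔨] [LieAlgebra ℂ 𝔨] {S T : Set (Irr 𝔨)} {X Y : Type*}
  [AddCommGroup X] [Module ℂ X] [LieRingModule 𝔨 X]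
  [AddCommGroup Y] [Module ℂ Y] [LieRingModule 𝔨 Y]

variable (S X) in
/-- All simple finite dimensional subquotients of the module `X` have their isomorphism class
in `S`. -/
def HasSubquotientsIn : Prop :=
  ∀ L : SimpleFD 𝔨, IsSubquotient ℂ 𝔨 L.carrier X → L.cls ∈ S

theorem HasSubquotientsIn.mono (hST : S ⊆ T) (h : HasSubquotientsIn S X) :
    HasSubquotientsIn T X :=
  fun L hL => hST (h L hL)

theorem HasSubquotientsIn.of_injective (g : X →ₗ⁅ℂ,𝔨⁆ Y) (hg : Function.Injective g)
    (h : HasSubquotientsIn S Y) : HasSubquotientsIn S X :=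
  fun L hL => h L (hL.of_injective g hg)

theorem HasSubquotientsIn.of_surjective (g : X →ₗ⁅ℂ,𝔨⁆ Y) (hg : Function.Surjective g)
    (h : HasSubquotientsIn S X) : HasSubquotientsIn S Y :=
  fun L hL => h L (hL.of_surjective g hg)

variable [LieModule ℂ 𝔨 X]

variable (S X) in
/-- The largest submodule of `X` all of whose simple finite dimensional subquotients have their
isomorphism class in `S`. -/
def component : LieSubmodule ℂ 𝔨 X where
  carrier := {x | ∃ F : LieSubmodule ℂ 𝔨 X, HasSubquotientsIn S F ∧ x ∈ F}
  zero_mem' := by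
    refine ⟨⊥, fun L hL => ?_, zero_mem _⟩
    have := LieModule.nontrivial_of_isIrreducible ℂ 𝔨 L.carrier
    exact absurd hL.nontrivial (not_nontrivial _)
  add_mem' := by
    rintro x y ⟨A, hA, hx⟩ ⟨B, hB, hy⟩
    exact ⟨A ⊔ B, fun L hL => hL.of_sup.elim (hA L) (hB L),
      add_mem (le_sup_left (a := A) hx) (le_sup_right (b := B) hy)⟩
  smul_mem' c _ := fun ⟨A, hA, hx⟩ => ⟨A, hA, A.smul_mem c hx⟩
  lie_mem := fun ⟨A, hA, hx⟩ => ⟨A, hA, A.lie_mem hx⟩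

theorem le_component {F : LieSubmodule ℂ 𝔨 X} (h : HasSubquotientsIn S F) : F ≤ component S X :=
  fun _ hx => ⟨F, h, hx⟩

theorem hasSubquotientsIn_component : HasSubquotientsIn S (component S X) := by
  intro L hL
  have hcover (x : component S X) : ∃ F : LieSubmodule ℂ 𝔨 (component S X),
      HasSubquotientsIn S F ∧ x ∈ F := by
    obtain ⟨A, hA, hx⟩ := x.2
    let g := comapRestrict (component S X).incl A
    have hg : Function.Injective g := fun a b hab =>
      Subtype.ext (Subtype.ext (congrArg (fun z : A => (z : X)) hab))
    exact ⟨A.comap (component S X).incl, hA.of_injective g hg, hx⟩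
  obtain ⟨F, hF, hLF⟩ := hL.exists_of_cover hcover
  exact hF L hLF

theorem hasSubquotientsIn_of_le_component {F : LieSubmodule ℂ 𝔨 X} (hF : F ≤ component S X) :
    HasSubquotientsIn S F :=
  hasSubquotientsIn_component.of_injective (LieSubmodule.inclusion hF)
    (LieSubmodule.inclusion_injective hF)

theorem component_mono (hST : S ⊆ T) : component S X ≤ component T X :=
  le_component (hasSubquotientsIn_component.mono hST)

theorem range_le_component (g : Y →ₗ⁅ℂ,𝔨⁆ X) (h : HasSubquotientsIn S Y) :
    g.range ≤ component S X :=
  le_component (h.of_surjective _ (surjective_rangeRestrict g))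

theorem map_component_le [LieModule ℂ 𝔨 Y] (g : X →ₗ⁅ℂ,𝔨⁆ Y) :
    (component S X).map g ≤ component S Y := by
  rintro _ ⟨x, hx, rfl⟩
  exact range_le_component (g.comp (component S X).incl) hasSubquotientsIn_component
    ((LieModuleHom.mem_range _ _).2 ⟨⟨x, hx⟩, rfl⟩)

theorem disjoint_component (hX : IsLocallyFinite 𝔨 X) (hST : Disjoint S T) :
    Disjoint (component S X) (component T X) := by
  rw [disjoint_iff, LieSubmodule.eq_bot_iff]
  intro x hx
  by_contra hne
  obtain ⟨F, hF, _, hxF⟩ := hX.exists_finiteDimensional_le hx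
  have : Nontrivial F := ⟨⟨x, hxF⟩, 0, fun h => hne (congrArg Subtype.val h)⟩
  obtain ⟨L, hL⟩ := exists_simpleFD_isSubquotient 𝔨 F
  exact Set.disjoint_left.1 hST (hasSubquotientsIn_of_le_component (hF.trans inf_le_left) L hL)
    (hasSubquotientsIn_of_le_component (hF.trans inf_le_right) L hL)

end Components

section BlockDecomposition

variable {𝔤 : Type*} [LieRing 𝔤] [LieAlgebra ℂ 𝔤] {𝔫 : LieSubalgebra ℂ 𝔤}

/-- The isomorphism classes in a block, which is an element of a quotient type. -/
def blockSet (I : Block 𝔫) : Set (Irr 𝔫) := {c | Quotient.mk (blockSetoid 𝔫) c = I}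

theorem disjoint_blockSet {I J : Block 𝔫} (h : I ≠ J) : Disjoint (blockSet I) (blockSet J) :=
  Set.disjoint_left.2 fun _ hI hJ => h (hI.symm.trans hJ)

theorem mk_cls_eq_of_linked {L S : SimpleFD 𝔫}
    (h : ShareIndecomposable 𝔫 L S ∨ OccursInTensor 𝔫 L S) :
    Quotient.mk (blockSetoid 𝔫) L.cls = Quotient.mk (blockSetoid 𝔫) S.cls :=
  Quotient.sound (Relation.EqvGen.rel _ _ ⟨L, S, rfl, rfl, h⟩)

theorem belongs_iff {L : Type*} [AddCommGroup L] [Module ℂ L] [LieRingModule 𝔫 L]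
    [LieModule ℂ 𝔫 L] {S : SimpleFD 𝔫} (e : L ≃ₗ⁅ℂ,𝔫⁆ S.carrier) {I : Block 𝔫} :
    Belongs 𝔫 L I ↔ S.cls ∈ blockSet I := by
  refine ⟨fun ⟨S', ⟨e'⟩, h⟩ => ?_, fun h => ⟨S, ⟨e⟩, h⟩⟩
  have hcls : S.cls = S'.cls := Quotient.sound ⟨e.symm.trans e'⟩
  rwa [hcls]

theorem hasFactorsIn_iff {N : Type} [AddCommGroup N] [Module ℂ N] [LieRingModule 𝔫 N]
    [LieModule ℂ 𝔫 N] {I : Block 𝔫} :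
    HasFactorsIn 𝔫 N I ↔ FiniteDimensional ℂ N ∧ HasSubquotientsIn (blockSet I) N := by
  refine and_congr_right fun _ => forall_congr' fun L => ?_
  rw [belongs_iff LieModuleEquiv.refl]
  exact imp_congr_left ⟨isSubquotient_of_finMult_ne_zero, fun h => h.finMult_ne_zero⟩

variable {X Y : Type*}
  [AddCommGroup X] [Module ℂ X] [LieRingModule 𝔫 X] [LieModule ℂ 𝔫 X]
  [AddCommGroup Y] [Module ℂ Y] [LieRingModule 𝔫 Y] [LieModule ℂ 𝔫 Y]

theorem IsIndecomposable.congr (e : X ≃ₗ⁅ℂ,𝔫⁆ Y) (h : IsIndecomposable 𝔫 X) :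
    IsIndecomposable 𝔫 Y := by
  obtain ⟨_, h⟩ := h
  refine ⟨e.injective.nontrivial, fun A B hAB => ?_⟩
  let o := (LieSubmodule.orderIsoMapComap e).symm
  exact (h (o A) (o B) (o.isCompl hAB)).imp (map_eq_bot_iff o).1 (map_eq_bot_iff o).1

theorem IsIndecomposable.exists_hasSubquotientsIn_blockSet [FiniteDimensional ℂ X]
    (h : IsIndecomposable 𝔫 X) : ∃ I : Block 𝔫, HasSubquotientsIn (blockSet I) X := by
  obtain ⟨Y, _, _, _, _, _, ⟨e⟩⟩ := exists_equiv_type 𝔫 X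
  have hY := h.congr e
  have := hY.1
  obtain ⟨L, hL⟩ := exists_simpleFD_isSubquotient 𝔫 Y
  refine ⟨Quotient.mk (blockSetoid 𝔫) L.cls, fun S hS => (mk_cls_eq_of_linked (.inl ?_)).symm⟩
  have hSY := hS.of_injective e.toLieModuleHom e.injective
  exact ⟨Y, _, _, _, _, ‹_›, hY, hL.finMult_ne_zero, hSY.finMult_ne_zero⟩

theorem exists_lt_sup_eq_of_not_isIndecomposable {F : LieSubmodule ℂ 𝔫 X} (hF : F ≠ ⊥)
    (h : ¬IsIndecomposable 𝔫 F) : ∃ A < F, ∃ B < F, A ⊔ B = F := by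
  have hF : Nontrivial F := (LieSubmodule.nontrivial_iff_ne_bot ℂ 𝔫 X).2 hF
  simp only [IsIndecomposable, hF, true_and, not_forall, not_or] at h
  obtain ⟨A, B, hAB, hA, hB⟩ := h
  have hA' : A < ⊤ := lt_top_iff_ne_top.2 fun h => hB (eq_bot_of_top_isCompl (h ▸ hAB))
  have hB' : B < ⊤ := lt_top_iff_ne_top.2 fun h => hA (eq_bot_of_isCompl_top (h ▸ hAB))
  refine ⟨A.map F.incl, LieSubmodule.map_incl_lt_iff_lt_top.2 hA',
    B.map F.incl, LieSubmodule.map_incl_lt_iff_lt_top.2 hB', ?_⟩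
  rw [← LieSubmodule.map_sup, hAB.sup_eq_top, LieSubmodule.map_incl_top]

theorem iSup_component_of_finiteDimensional [FiniteDimensional ℂ X] :
    ⨆ I : Block 𝔫, component (blockSet I) X = ⊤ := by
  have := LieSubmodule.wellFoundedLT_of_isArtinian ℂ 𝔫 X
  suffices h : ∀ F : LieSubmodule ℂ 𝔫 X, F ≤ ⨆ I : Block 𝔫, component (blockSet I) X from
    eq_top_iff.2 (h ⊤)
  intro F
  induction F using WellFoundedLT.induction with
  | ind F ih =>
    rcases eq_or_ne F ⊥ with rfl | hne
    · exact bot_le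
    by_cases hF : IsIndecomposable 𝔫 F
    · obtain ⟨I, hI⟩ := hF.exists_hasSubquotientsIn_blockSet
      exact le_iSup_of_le I (le_component hI)
    · obtain ⟨A, hA, B, hB, rfl⟩ := exists_lt_sup_eq_of_not_isIndecomposable hne hF
      exact sup_le (ih A hA) (ih B hB)

theorem iSup_component (hX : IsLocallyFinite 𝔫 X) :
    ⨆ I : Block 𝔫, component (blockSet I) X = ⊤ := by
  refine eq_top_iff.2 fun x _ => ?_
  obtain ⟨F, _, hx⟩ := isLocallyFinite_iff.1 hX x
  have hF : F ≤ ⨆ I : Block 𝔫, component (blockSet I) X := by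
    rw [← F.map_incl_top, ← iSup_component_of_finiteDimensional, LieSubmodule.map_iSup]
    exact iSup_mono fun I => map_component_le F.incl
  exact hF hx

theorem iSupIndep_component (hX : IsLocallyFinite 𝔫 X) :
    iSupIndep fun I : Block 𝔫 => component (blockSet I) X := by
  intro I
  refine (disjoint_component hX (disjoint_compl_right (a := blockSet I))).mono_right ?_
  exact iSup₂_le fun J hJ => component_mono (disjoint_blockSet hJ).subset_compl_right

end BlockDecomposition

section Stability

theorem IsSubquotient.tensor_of_exact {R 𝔨 L V X Y Z : Type*} [CommRing R]
    [LieRing 𝔨] [LieAlgebra R 𝔨]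
    [AddCommGroup L] [Module R L] [LieRingModule 𝔨 L] [LieModule.IsIrreducible R 𝔨 L]
    [AddCommGroup V] [Module R V] [LieRingModule 𝔨 V] [LieModule R 𝔨 V]
    [AddCommGroup X] [Module R X] [LieRingModule 𝔨 X] [LieModule R 𝔨 X]
    [AddCommGroup Y] [Module R Y] [LieRingModule 𝔨 Y] [LieModule R 𝔨 Y]
    [AddCommGroup Z] [Module R Z] [LieRingModule 𝔨 Z] [LieModule R 𝔨 Z]
    {i : X →ₗ⁅R,𝔨⁆ Y} {q : Y →ₗ⁅R,𝔨⁆ Z} (hiq : Function.Exact i q) (hq : Function.Surjective q)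
    (h : IsSubquotient R 𝔨 L (V ⊗[R] Y)) :
    IsSubquotient R 𝔨 L (V ⊗[R] X) ∨ IsSubquotient R 𝔨 L (V ⊗[R] Z) := by
  have hexact := lTensor_exact V (f := (i : X →ₗ[R] Y)) (g := (q : Y →ₗ[R] Z)) hiq hq
  refine h.of_exact (TensorProduct.LieModule.map .id i) (TensorProduct.LieModule.map .id q) .id
    (fun t ht => ?_) fun t _ => (LieModuleHom.mem_range _ _).2 ⟨t, rfl⟩
  exact (LieModuleHom.mem_range _ _).2 ((hexact t).1 (LieModuleHom.mem_ker.1 ht))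

theorem IsSubquotient.exists_of_tensor {𝔨 L V F : Type*} [LieRing 𝔨] [LieAlgebra ℂ 𝔨]
    [AddCommGroup L] [Module ℂ L] [LieRingModule 𝔨 L] [LieModule.IsIrreducible ℂ 𝔨 L]
    [AddCommGroup V] [Module ℂ V] [LieRingModule 𝔨 V] [LieModule ℂ 𝔨 V]
    [AddCommGroup F] [Module ℂ F] [LieRingModule 𝔨 F] [LieModule ℂ 𝔨 F] [FiniteDimensional ℂ F]
    (h : IsSubquotient ℂ 𝔨 L (V ⊗[ℂ] F)) :
    ∃ S : SimpleFD 𝔨, IsSubquotient ℂ 𝔨 S.carrier F ∧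
      IsSubquotient ℂ 𝔨 L (V ⊗[ℂ] S.carrier) := by
  induction hn : Module.finrank ℂ F using Nat.strong_induction_on generalizing F with
  | _ n ih =>
    have := LieModule.nontrivial_of_isIrreducible ℂ 𝔨 L
    have : Nontrivial F := by
      by_contra! hF
      have := h.nontrivial
      exact not_nontrivial (V ⊗[ℂ] F) this
    obtain ⟨S, f, hf⟩ := exists_simpleFD_injective 𝔨 F
    let q := LieSubmodule.Quotient.mk' f.range
    have hq : Function.Surjective q := LieSubmodule.Quotient.surjective_mk' _
    have hfq : Function.Exact f q := fun x =>
      (LieSubmodule.Quotient.mk_eq_zero f.range).trans (LieModuleHom.mem_range f x)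
    have : FiniteDimensional ℂ (F ⧸ f.range) :=
      Module.Finite.of_surjective (q : F →ₗ[ℂ] F ⧸ f.range) hq
    rcases h.tensor_of_exact hfq hq with h | h
    · exact ⟨S, (IsSubquotient.refl ℂ 𝔨 _).of_injective f hf, h⟩
    · have hlt : Module.finrank ℂ (F ⧸ f.range) < n := by
        have := LieModule.nontrivial_of_isIrreducible ℂ 𝔨 S.carrier
        have hadd := Submodule.finrank_quotient_add_finrank f.range.toSubmodule
        have hpos : 0 < Module.finrank ℂ S.carrier := Module.finrank_pos
        have hrange : Module.finrank ℂ f.range.toSubmodule = Module.finrank ℂ S.carrier := by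
          rw [LieModuleHom.toSubmodule_range]
          exact LinearMap.finrank_range_of_inj (f := (f : S.carrier →ₗ[ℂ] F)) hf
        change Module.finrank ℂ (F ⧸ f.range.toSubmodule) < n
        omega
      obtain ⟨T, hT, hL⟩ := ih _ hlt h rfl
      exact ⟨T, hT.of_surjective q hq, hL⟩

variable {𝔤 : Type*} [LieRing 𝔤] [LieAlgebra ℂ 𝔤] {𝔫 : LieSubalgebra ℂ 𝔤}

theorem HasSubquotientsIn.adjQuot_tensor (h𝔫 : IsLocallyFinite 𝔫 (AdjQuot 𝔫)) {I : Block 𝔫}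
    {F : Type*} [AddCommGroup F] [Module ℂ F] [LieRingModule 𝔫 F] [LieModule ℂ 𝔫 F]
    [FiniteDimensional ℂ F] (hF : HasSubquotientsIn (blockSet I) F) :
    HasSubquotientsIn (blockSet I) (AdjQuot 𝔫 ⊗[ℂ] F) := by
  intro L hL
  obtain ⟨S, hS, hLS⟩ := hL.exists_of_tensor
  have hocc : OccursInTensor 𝔫 S L :=
    hLS.mult_ne_zero (h𝔫.tensorProduct isLocallyFinite_of_finiteDimensional)
  exact (mk_cls_eq_of_linked (.inr hocc)).symm.trans (hF S hS)

variable {M : Type*} [AddCommGroup M] [Module ℂ M] [LieRingModule 𝔤 M] [LieModule ℂ 𝔤 M]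

/-- The map `𝔤/𝔫 ⊗ F → M/F` induced by the action of `𝔤` on `M`, for an `𝔫`-submodule `F`
of `M`. -/
def adjQuotAction (F : LieSubmodule ℂ 𝔫 M) : AdjQuot 𝔫 ⊗[ℂ] F →ₗ⁅ℂ,𝔫⁆ M ⧸ F :=
  let q := LieSubmodule.Quotient.mk' F
  let β : 𝔤 →ₗ[ℂ] F →ₗ[ℂ] M ⧸ F :=
    ((LieModule.toEnd ℂ 𝔤 M : 𝔤 →ₗ[ℂ] Module.End ℂ M).compr₂
      (q : M →ₗ[ℂ] M ⧸ F)).domRestrict₂ F.toSubmodule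
  let γ : AdjQuot 𝔫 →ₗ[ℂ] F →ₗ[ℂ] M ⧸ F :=
    𝔫.toLieSubmodule.toSubmodule.liftQ β fun x hx => LinearMap.ext fun v =>
      (LieSubmodule.Quotient.mk_eq_zero F).2 (F.lie_mem (x := (⟨x, hx⟩ : 𝔫)) v.2)
  { TensorProduct.lift γ with
    map_lie' {y t} := by
      change TensorProduct.lift γ ⁅y, t⁆ = ⁅y, TensorProduct.lift γ t⁆
      induction t with
      | zero => simp only [lie_zero, map_zero]
      | add s t hs ht => rw [lie_add, map_add, hs, ht, map_add, lie_add]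
      | tmul a v =>
        obtain ⟨x, rfl⟩ := LieSubmodule.Quotient.surjective_mk' _ a
        rw [TensorProduct.LieModule.lie_tmul_right, map_add]
        change q ⁅⁅(y : 𝔤), x⁆, (v : M)⁆ + q ⁅x, ⁅(y : 𝔤), (v : M)⁆⁆ = ⁅y, q ⁅x, (v : M)⁆⁆
        rw [← map_add, ← leibniz_lie, ← LieModuleHom.map_lie,
          LieSubalgebra.coe_bracket_of_module] }

theorem adjQuotAction_tmul (F : LieSubmodule ℂ 𝔫 M) (x : 𝔤) (v : F) :
    adjQuotAction F (LieSubmodule.Quotient.mk' 𝔫.toLieSubmodule x ⊗ₜ v) =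
      LieSubmodule.Quotient.mk' F ⁅x, (v : M)⁆ :=
  rfl

theorem HasSubquotientsIn.comap_range_adjQuotAction (h𝔫 : IsLocallyFinite 𝔫 (AdjQuot 𝔫))
    {I : Block 𝔫} {F : LieSubmodule ℂ 𝔫 M} [FiniteDimensional ℂ F]
    (hF : HasSubquotientsIn (blockSet I) F) :
    HasSubquotientsIn (blockSet I)
      ((adjQuotAction F).range.comap (LieSubmodule.Quotient.mk' F)) := by
  intro L hL
  let q := LieSubmodule.Quotient.mk' F
  let G := (adjQuotAction F).range.comap q
  have hFG : F ≤ G := fun v hv => by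
    have hqv : q v = 0 := (LieSubmodule.Quotient.mk_eq_zero F).2 hv
    exact LieSubmodule.mem_comap.2 (hqv ▸ zero_mem _)
  have hker : (q.comp G.incl).ker ≤ (LieSubmodule.inclusion hFG).range := fun y hy =>
    (LieModuleHom.mem_range _ _).2 ⟨⟨y, (LieSubmodule.Quotient.mk_eq_zero F).1 hy⟩, rfl⟩
  have hrange : (q.comp G.incl).range ≤ (adjQuotAction F).range := fun w hw => by
    obtain ⟨y, rfl⟩ := (LieModuleHom.mem_range _ _).1 hw
    exact y.2
  exact (hL.of_exact _ _ _ hker hrange).elim (hF L) (hF.adjQuot_tensor h𝔫 L)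

theorem lie_mem_component (h𝔫 : IsLocallyFinite 𝔫 (AdjQuot 𝔫)) (hM : IsLocallyFinite 𝔫 M)
    {I : Block 𝔫} (x : 𝔤) {m : M} (hm : m ∈ component (𝔨 := 𝔫) (blockSet I) M) :
    ⁅x, m⁆ ∈ component (𝔨 := 𝔫) (blockSet I) M := by
  obtain ⟨F, hF, _, hmF⟩ := hM.exists_finiteDimensional_le hm
  have hG := (hasSubquotientsIn_of_le_component hF).comap_range_adjQuotAction h𝔫
  exact le_component hG ((LieModuleHom.mem_range _ _).2 ⟨_, adjQuotAction_tmul F x ⟨m, hmF⟩⟩)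

variable (M) in
/-- The component of a block `I` as a `𝔤`-submodule. -/
def blockSubmodule (h𝔫 : IsLocallyFinite 𝔫 (AdjQuot 𝔫)) (hM : IsLocallyFinite 𝔫 M)
    (I : Block 𝔫) : LieSubmodule ℂ 𝔤 M :=
  { (component (𝔨 := 𝔫) (blockSet I) M).toSubmodule with
    lie_mem := lie_mem_component h𝔫 hM _ }

end Stability

section InducedModule

attribute [local instance 100] LieRing.ofAssociativeRing

open UniversalEnvelopingAlgebra (ι)

variable {𝔤 : Type*} [LieRing 𝔤] [LieAlgebra ℂ 𝔤] {𝔫 : LieSubalgebra ℂ 𝔤}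
  {N M : Type*} [AddCommGroup N] [Module ℂ N]
  [AddCommGroup M] [Module ℂ M] [LieRingModule 𝔤 M] [LieModule ℂ 𝔤 M]

theorem envIncl_ι (y : 𝔫) : envIncl 𝔫 (ι ℂ y) = ι ℂ (y : 𝔤) := by
  rw [envIncl, UniversalEnvelopingAlgebra.lift_ι_apply]
  rfl

theorem envAct_envIncl (w : UniversalEnvelopingAlgebra ℂ 𝔫) (m : M) :
    envAct 𝔤 M (envIncl 𝔫 w) m = envAct 𝔫 M w m := by
  have h : (envAct 𝔤 M).comp (envIncl 𝔫) = envAct 𝔫 M := by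
    apply UniversalEnvelopingAlgebra.hom_ext ℂ
    ext y m
    change envAct 𝔤 M (envIncl 𝔫 (ι ℂ y)) m = envAct 𝔫 M (ι ℂ y) m
    rw [envIncl_ι, envAct_ι, envAct_ι, LieSubalgebra.coe_bracket_of_module]
  exact LinearMap.congr_fun (DFunLike.congr_fun h w) m

/-- The map `u ⊗ v ↦ u f(v)`; if `f` is an `𝔫`-homomorphism, it descends to the extension
`indLift f` of `f` to the induced module. -/
def tensorLift (f : N →ₗ[ℂ] M) : UniversalEnvelopingAlgebra ℂ 𝔤 ⊗[ℂ] N →ₗ[ℂ] M :=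
  TensorProduct.lift ((envAct 𝔤 M).toLinearMap.compl₂ f)

theorem tensorLift_tmul (f : N →ₗ[ℂ] M) (u : UniversalEnvelopingAlgebra ℂ 𝔤) (v : N) :
    tensorLift f (u ⊗ₜ v) = envAct 𝔤 M u (f v) :=
  rfl

theorem tensorLift_smul (f : N →ₗ[ℂ] M) (u : UniversalEnvelopingAlgebra ℂ 𝔤)
    (t : UniversalEnvelopingAlgebra ℂ 𝔤 ⊗[ℂ] N) :
    tensorLift f (u • t) = envAct 𝔤 M u (tensorLift f t) := by
  induction t with
  | zero => rw [smul_zero, map_zero, map_zero]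
  | add s t hs ht => rw [smul_add, map_add, map_add, hs, ht, map_add]
  | tmul u' v =>
    rw [TensorProduct.smul_tmul', smul_eq_mul, tensorLift_tmul, tensorLift_tmul, map_mul,
      Module.End.mul_apply]

variable [LieRingModule 𝔫 N] [LieModule ℂ 𝔫 N]

theorem envAct_ind (u : UniversalEnvelopingAlgebra ℂ 𝔤) (m : Ind 𝔫 N) :
    envAct 𝔤 (Ind 𝔫 N) u m = u • m := by
  have h : envAct 𝔤 (Ind 𝔫 N) = Algebra.lsmul ℂ ℂ (Ind 𝔫 N) := by
    refine UniversalEnvelopingAlgebra.hom_ext ℂ (LieHom.ext fun x => LinearMap.ext fun m => ?_)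
    exact envAct_ι x m
  rw [h, Algebra.lsmul_coe]

variable (𝔫 N) in
/-- The canonical map `v ↦ 1 ⊗ v` from `N` to the module induced from `N`. -/
def indMk : N →ₗ⁅ℂ,𝔫⁆ Ind 𝔫 N where
  toFun v := (balancedRel 𝔫 N).mkQ (1 ⊗ₜ v)
  map_add' v w := by rw [TensorProduct.tmul_add, map_add]
  map_smul' c v := by
    rw [TensorProduct.tmul_smul]
    rfl
  map_lie' {y v} := by
    have h : (balancedRel 𝔫 N).mkQ ((1 * envIncl 𝔫 (ι ℂ y)) ⊗ₜ[ℂ] v)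
        = (balancedRel 𝔫 N).mkQ (1 ⊗ₜ[ℂ] envAct 𝔫 N (ι ℂ y) v) :=
      (Submodule.Quotient.eq _).2 (Submodule.subset_span ⟨1, ι ℂ y, v, rfl⟩)
    rw [envAct_ι, envIncl_ι, one_mul] at h
    refine h.symm.trans ?_
    change _ = (balancedRel 𝔫 N).mkQ (ι ℂ (y : 𝔤) • (1 ⊗ₜ[ℂ] v))
    rw [TensorProduct.smul_tmul', smul_eq_mul, mul_one]

theorem mk_tmul_eq_smul_indMk (u : UniversalEnvelopingAlgebra ℂ 𝔤) (v : N) :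
    (balancedRel 𝔫 N).mkQ (u ⊗ₜ[ℂ] v) = u • indMk 𝔫 N v := by
  change _ = (balancedRel 𝔫 N).mkQ (u • (1 ⊗ₜ[ℂ] v))
  rw [TensorProduct.smul_tmul', smul_eq_mul, mul_one]

theorem eq_top_of_indMk_mem {Q : LieSubmodule ℂ 𝔤 (Ind 𝔫 N)} (hQ : ∀ v, indMk 𝔫 N v ∈ Q) :
    Q = ⊤ := by
  refine eq_top_iff.2 fun m _ => ?_
  obtain ⟨t, rfl⟩ := (balancedRel 𝔫 N).mkQ_surjective m
  induction t with
  | zero => exact map_zero (balancedRel 𝔫 N).mkQ ▸ zero_mem Q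
  | add s t hs ht => exact map_add (balancedRel 𝔫 N).mkQ s t ▸ add_mem (hs trivial) (ht trivial)
  | tmul u v =>
    rw [mk_tmul_eq_smul_indMk, ← envAct_ind]
    exact envAct_mem u (hQ v)

theorem balancedRel_le_ker_tensorLift (f : N →ₗ⁅ℂ,𝔫⁆ M) :
    (balancedRel 𝔫 N).restrictScalars ℂ ≤ LinearMap.ker (tensorLift (f : N →ₗ[ℂ] M)) := by
  intro t (ht : t ∈ balancedRel 𝔫 N)
  rw [LinearMap.mem_ker]
  induction ht using Submodule.span_induction with
  | mem t h =>
    obtain ⟨u, w, v, rfl⟩ := h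
    rw [map_sub, tensorLift_tmul, tensorLift_tmul, map_mul, Module.End.mul_apply,
      envAct_envIncl, LieModuleHom.coe_toLinearMap, map_envAct, sub_self]
  | zero => exact map_zero _
  | add s t _ _ hs ht => rw [map_add, hs, ht, add_zero]
  | smul u t _ ht => rw [tensorLift_smul, ht, map_zero]

/-- The extension of an `𝔫`-homomorphism `f : N → M` into a `𝔤`-module to the module induced
from `N`. -/
def indLift (f : N →ₗ⁅ℂ,𝔫⁆ M) : Ind 𝔫 N →ₗ⁅ℂ,𝔤⁆ M :=
  let φ : Ind 𝔫 N →ₗ[ℂ] M :=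
    ((balancedRel 𝔫 N).restrictScalars ℂ).liftQ (tensorLift f)
      (balancedRel_le_ker_tensorLift f) ∘ₗ
      (Submodule.Quotient.restrictScalarsEquiv ℂ (balancedRel 𝔫 N)).symm.toLinearMap
  { φ with
    map_lie' {x m} := by
      obtain ⟨t, rfl⟩ := (balancedRel 𝔫 N).mkQ_surjective m
      change tensorLift (f : N →ₗ[ℂ] M) (ι ℂ x • t) = ⁅x, tensorLift (f : N →ₗ[ℂ] M) t⁆
      rw [tensorLift_smul, envAct_ι] }

theorem indLift_indMk (f : N →ₗ⁅ℂ,𝔫⁆ M) (v : N) : indLift f (indMk 𝔫 N v) = f v := by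
  change tensorLift (f : N →ₗ[ℂ] M) (1 ⊗ₜ v) = f v
  rw [tensorLift_tmul, map_one, Module.End.one_apply, LieModuleHom.coe_toLinearMap]

end InducedModule

section Traces

variable {𝔤 : Type*} [LieRing 𝔤] [LieAlgebra ℂ 𝔤] {𝔫 : LieSubalgebra ℂ 𝔤}
  {M : Type*} [AddCommGroup M] [Module ℂ M] [LieRingModule 𝔤 M] [LieModule ℂ 𝔤 M]

theorem range_le_traceSubspace {N : Type*} [AddCommGroup N] [Module ℂ N] [LieRingModule 𝔫 N]
    [LieModule ℂ 𝔫 N] [FiniteDimensional ℂ N] {I : Block 𝔫}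
    (hN : HasSubquotientsIn (blockSet I) N) (f : N →ₗ⁅ℂ,𝔫⁆ M) :
    LinearMap.range (f : N →ₗ[ℂ] M) ≤ traceSubspace 𝔫 M I := by
  obtain ⟨Y, i₁, i₂, i₃, i₄, _, ⟨e⟩⟩ := exists_equiv_type 𝔫 N
  have hY : HasFactorsIn 𝔫 Y I :=
    hasFactorsIn_iff.2 ⟨‹_›, hN.of_surjective e.toLieModuleHom e.surjective⟩
  let φ := indLift (f.comp e.symm.toLieModuleHom)
  have hφ : LinearMap.range (φ : Ind 𝔫 Y →ₗ[ℂ] M) ≤ traceSubspace 𝔫 M I :=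
    le_iSup_of_le Y <| le_iSup_of_le i₁ <| le_iSup_of_le i₂ <| le_iSup_of_le i₃ <|
      le_iSup_of_le i₄ <| le_iSup_of_le hY <| le_iSup_of_le φ le_rfl
  rintro _ ⟨v, rfl⟩
  refine hφ ⟨indMk 𝔫 Y (e v), (indLift_indMk _ _).trans ?_⟩
  exact congrArg f (e.symm_apply_apply v)

variable (h𝔫 : IsLocallyFinite 𝔫 (AdjQuot 𝔫)) (hM : IsLocallyFinite 𝔫 M)

theorem range_le_blockSubmodule {N : Type*} [AddCommGroup N] [Module ℂ N] [LieRingModule 𝔫 N]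
    [LieModule ℂ 𝔫 N] {I : Block 𝔫} (hN : HasSubquotientsIn (blockSet I) N)
    (φ : Ind 𝔫 N →ₗ⁅ℂ,𝔤⁆ M) :
    LinearMap.range (φ : Ind 𝔫 N →ₗ[ℂ] M) ≤ (blockSubmodule M h𝔫 hM I).toSubmodule := by
  let g : N →ₗ⁅ℂ,𝔫⁆ M := (φ.restrictLie 𝔫).comp (indMk 𝔫 N)
  have htop : (blockSubmodule M h𝔫 hM I).comap φ = ⊤ := eq_top_of_indMk_mem fun v =>
    range_le_component g hN ((LieModuleHom.mem_range g _).2 ⟨v, rfl⟩)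
  rintro _ ⟨m, rfl⟩
  exact LieSubmodule.mem_comap.1 (htop ▸ LieSubmodule.mem_top m)

variable (I : Block 𝔫)

theorem blockSubmodule_eq_traceSubspace :
    (blockSubmodule M h𝔫 hM I).toSubmodule = traceSubspace 𝔫 M I := by
  apply le_antisymm
  · intro m hm
    obtain ⟨F, hF, _, hmF⟩ := hM.exists_finiteDimensional_le (A := component (blockSet I) M) hm
    exact range_le_traceSubspace (hasSubquotientsIn_of_le_component hF) F.incl ⟨⟨m, hmF⟩, rfl⟩
  · exact iSup_le fun N => iSup_le fun _ => iSup_le fun _ => iSup_le fun _ => iSup_le fun _ =>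
      iSup_le fun hN => iSup_le fun φ => range_le_blockSubmodule h𝔫 hM (hasFactorsIn_iff.1 hN).2 φ

theorem hasSubquotientsIn_blockSubmodule :
    HasSubquotientsIn (blockSet I) (blockSubmodule M h𝔫 hM I) := by
  let j : blockSubmodule M h𝔫 hM I →ₗ⁅ℂ,𝔫⁆ component (𝔨 := 𝔫) (blockSet I) M :=
    ((blockSubmodule M h𝔫 hM I).incl.restrictLie 𝔫).codRestrict _ fun m => m.2
  exact hasSubquotientsIn_component.of_injective j fun a b hab =>
    Subtype.ext (congrArg (fun z : component (𝔨 := 𝔫) (blockSet I) M => (z : M)) hab)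

theorem belongs_of_mult_blockSubmodule_ne_zero (L : Type*) [AddCommGroup L] [Module ℂ L]
    [LieRingModule 𝔫 L] [LieModule ℂ 𝔫 L] [FiniteDimensional ℂ L] [LieModule.IsIrreducible ℂ 𝔫 L]
    (hL : mult 𝔫 (blockSubmodule M h𝔫 hM I) L ≠ 0) : Belongs 𝔫 L I := by
  obtain ⟨S, ⟨e⟩⟩ := exists_simpleFD_equiv 𝔫 L
  have hS := (isSubquotient_of_mult_ne_zero hL).congr_left e
  exact (belongs_iff e).2 (hasSubquotientsIn_blockSubmodule h𝔫 hM I S hS)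

theorem isInternal_blockSubmodule [DecidableEq (Block 𝔫)] :
    DirectSum.IsInternal fun I : Block 𝔫 => blockSubmodule M h𝔫 hM I := by
  have hind := LieSubmodule.iSupIndep_toSubmodule.2 (iSupIndep_component (𝔫 := 𝔫) hM)
  have hsup := LieSubmodule.iSup_toSubmodule_eq_top.2 (iSup_component (𝔫 := 𝔫) hM)
  exact DirectSum.isInternal_submodule_of_iSupIndep_of_iSup_eq_top hind hsup

theorem hom_blockSubmodule_eq_zero {I J : Block 𝔫} (hIJ : I ≠ J)
    (f : blockSubmodule M h𝔫 hM I →ₗ⁅ℂ,𝔤⁆ blockSubmodule M h𝔫 hM J) : f = 0 := by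
  let g : blockSubmodule M h𝔫 hM I →ₗ⁅ℂ,𝔫⁆ M :=
    ((blockSubmodule M h𝔫 hM J).incl.comp f).restrictLie 𝔫
  refine LieModuleHom.ext fun m => Subtype.ext ?_
  have hI : g m ∈ component (𝔨 := 𝔫) (blockSet I) M :=
    range_le_component g (hasSubquotientsIn_blockSubmodule h𝔫 hM I)
      ((LieModuleHom.mem_range g _).2 ⟨m, rfl⟩)
  have hJ : g m ∈ component (𝔨 := 𝔫) (blockSet J) M := (f m).2
  exact (LieSubmodule.mem_bot _).1
    ((disjoint_component hM (disjoint_blockSet hIJ)).le_bot ⟨hI, hJ⟩)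

end Traces

end LieBlocks

theorem theorem11 {𝔤 : Type*} [LieRing 𝔤] [LieAlgebra ℂ 𝔤] (𝔫 : LieSubalgebra ℂ 𝔤)
    (h𝔫 : LieBlocks.IsLocallyFinite 𝔫 (LieBlocks.AdjQuot 𝔫))
    (M : Type*) [AddCommGroup M] [Module ℂ M] [LieRingModule 𝔤 M] [LieModule ℂ 𝔤 M]
    (hM : LieBlocks.IsLocallyFinite 𝔫 M)
    [DecidableEq (LieBlocks.Block 𝔫)] :
    ∃ P : LieBlocks.Block 𝔫 → LieSubmodule ℂ 𝔤 M,
      -- each `M_I` is a `𝔤`-submodule, namely `P I`, and its factors over `𝔫` lie in `I`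
      (∀ I, (P I).toSubmodule = LieBlocks.traceSubspace 𝔫 M I) ∧
      (∀ (I : LieBlocks.Block 𝔫) (L : Type*) [AddCommGroup L] [Module ℂ L] [LieRingModule 𝔫 L]
        [LieModule ℂ 𝔫 L] [FiniteDimensional ℂ L] [LieModule.IsIrreducible ℂ 𝔫 L],
        LieBlocks.mult 𝔫 (P I) L ≠ 0 → LieBlocks.Belongs 𝔫 L I) ∧
      -- `M` is the direct sum of the `M_I`
      DirectSum.IsInternal P ∧
      -- there are no nonzero homomorphisms between different summands
      (∀ I J : LieBlocks.Block 𝔫, I ≠ J → ∀ f : P I →ₗ⁅ℂ,𝔤⁆ P J, f = 0) := by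
  refine ⟨fun I => LieBlocks.blockSubmodule M h𝔫 hM I,
    LieBlocks.blockSubmodule_eq_traceSubspace h𝔫 hM, ?_,
    LieBlocks.isInternal_blockSubmodule h𝔫 hM,
    fun I J hIJ f => LieBlocks.hom_blockSubmodule_eq_zero h𝔫 hM hIJ f⟩
  intro I L _ _ _ _ _ _ hL
  exact LieBlocks.belongs_of_mult_blockSubmodule_ne_zero h𝔫 hM I L hL
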